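/- For integers $n,k\ge 0$ let $$B(n,k)=\sum_{i=k}^{n}(-1)^{k-i}2^{n-i}\binom{n}{i}$$ (an empty sum, hence $0$, if $k>n$). Let $\widehat{\mathcal Q}_{n+1}$ be the set of permutations $\pi$ of $[n+1]=\{1,\dots,n+1\}$ such that the cycle of $\pi$ containing $n+1$, when written with its largest element $n+1$ last, i.e. as $(\pi(n+1),\pi^2(n+1),\dots,\pi^{\ell}(n+1)=n+1)$ with $\ell$ the length of that cycle, is an increasing sequence. For a permutation $\pi$ of $[n+1]$ let $\mathrm{cyc}(\pi)$ be its number of cycles (fixed points included), $\mathrm{exc}(\pi)=\#\{i:\pi(i)>i\}$ its number of excedances and $\mathrm{aexc}(\pi)=\#\{i:\pi(i)\le i\}$ its number of anti-excedances. **Theorem.** For all integers $n\ge 0$ and $k\ge 0$, $$B(n,k)=\sum_{\substack{\pi\in\widehat{\mathcal Q}_{n+1}\\ \mathrm{exc}(\pi)=n-k}}(-1)^{\mathrm{cyc}(\pi)+\mathrm{aexc}(\pi)}.$$ -/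

import Mathlib

namespace BinomialEulerian

/-- `B(n,k) = ∑_{i=k}^n (-1)^{k-i} 2^{n-i} C(n,i)`. The exponent `k - i` is an integer. -/
def B (n k : ℕ) : ℤ :=
  ∑ i ∈ Finset.Icc k n,
    (((-1 : ℤˣ) ^ ((k : ℤ) - (i : ℤ)) : ℤˣ) : ℤ) * 2 ^ (n - i) * (n.choose i : ℤ)

/-- The number of excedances: indices `i` with `π(i) > i`. -/
def exc {N : ℕ} (π : Equiv.Perm (Fin N)) : ℕ :=
  (Finset.univ.filter fun i => i < π i).card

/-- The number of anti-excedances: indices `i` with `π(i) ≤ i`. -/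
def aexc {N : ℕ} (π : Equiv.Perm (Fin N)) : ℕ :=
  (Finset.univ.filter fun i => π i ≤ i).card

/-- The number of cycles of `π`, fixed points included
(`π.partition` is the multiset of all cycle lengths, with a part `1` for every fixed point). -/
def cyc {N : ℕ} (π : Equiv.Perm (Fin N)) : ℕ :=
  π.partition.parts.card

/-- The permutations of an `(n+1)`-element chain for which the cycle through the maximum `m`,
written so that it ends with `m`, that is as `(π m, π² m, …, π^ℓ m = m)` with `ℓ` the length of
this cycle, is an increasing sequence. -/
def IsQhat {n : ℕ} (π : Equiv.Perm (Fin (n + 1))) : Prop :=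
  StrictMonoOn (fun j : ℕ => (π ^ j) (Fin.last n))
    (Set.Icc 1 (Function.minimalPeriod π (Fin.last n)))

open Classical in
/-- The set `Q̂_{n+1}` of permutations of `[n+1]`, with `[n+1]` modelled by `Fin (n+1)` and
its largest element by `Fin.last n`. -/
noncomputable def Qhat (n : ℕ) : Finset (Equiv.Perm (Fin (n + 1))) :=
  Finset.univ.filter fun π => IsQhat π

end BinomialEulerian

/-!
Since `(-1) ^ cyc π = (-1) ^ N * sign π` and `exc π + aexc π = N` for a permutation of `N` points,
the sum is, up to the sign `(-1) ^ (n - k)`, the coefficient of `u ^ (n - k)` in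
`∑ π ∈ Qhat n, sign π * u ^ exc π`.

This generating function is a sum of determinants. A permutation lies in `Qhat n` exactly when, on
some set `S` containing the maximum, it sends each element to the next larger element of `S` and the
maximum to the smallest one; the set `S`, the orbit of the maximum, is then unique
(`sum_Qhat_eq_sum_det`). On the complement of `S` the permutation is arbitrary. Hence the
contribution of `S` is the determinant of a matrix that is block triangular (`det_cycleMatrix`):
the block of `S` is a weighted cyclic permutation matrix, with determinant `(-u) ^ (#S - 1)`, and
the other block has entries `u` above the diagonal and `1` elsewhere, with determinant
`(1 - u) ^ (r - 1)` for its size `r > 0` (`det_excWeight`).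

Summing over `S` by the binomial theorem gives
`(1 - u) * ∑ π ∈ Qhat n, sign π * u ^ exc π = (1 - 2 * u) ^ n + (-u) ^ (n + 1)`
(`one_sub_mul_sum_Qhat`). At `u = -X` this says that the sum `a j` of the signs attached to the
permutations with `j` excedances satisfies `a (j + 1) + a j = 2 ^ (j + 1) * C(n, j + 1)` for
`j < n`, with `a 0 = 1`. The numbers `B n (n - j)` obey the same recurrence (`B_add_B_succ`).
-/

namespace BinomialEulerian

open Finset Matrix

/-! ### Determinants -/

/-- In the expansion of this determinant `π` contributes `sign π * u ^ exc π`. Subtracting from each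
row its predecessor makes the matrix upper triangular. -/
theorem det_excWeight_fin {R : Type*} [CommRing R] (u : R) (m : ℕ) :
    det (of fun i j : Fin m => if i < j then u else 1) = (1 - u) ^ (m - 1) := by
  cases m with
  | zero => simp
  | succ m =>
    rw [det_eq_of_forall_row_eq_smul_add_pred
      (B := of (Fin.cons (fun j => if 0 < j then u else 1)
        (fun i j => if j = i.succ then 1 - u else 0))) (fun _ => 1)]
    · rw [det_of_isUpperTriangular]
      · simp [Fin.prod_univ_succ]
      · intro i j hij
        induction i using Fin.cases with
        | zero => exact absurd hij (Fin.not_lt_zero j)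
        | succ i => simpa using fun h : j = i.succ => absurd hij (by simp [h])
    · intro j
      simp
    · intro i j
      rcases lt_trichotomy j i.succ with h | rfl | h
      · have h' : ¬ i.castSucc < j := by rw [Fin.lt_def] at *; simp at *; omega
        simp [h.ne, h.not_gt, h']
      · simp
      · have h' : i.castSucc < j := by rw [Fin.lt_def] at *; simp at *; omega
        simp [h.ne', h, h']

/-- The truncated exponent gives the correct value `1` when `α` is empty. -/
theorem det_excWeight {R α : Type*} [CommRing R] [LinearOrder α] [Fintype α] [DecidableEq α]
    (u : R) : det (of fun i j : α => if i < j then u else 1) = (1 - u) ^ (Fintype.card α - 1) := by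
  rw [← det_excWeight_fin,
    ← det_submatrix_equiv_self (Fintype.orderIsoFinOfCardEq α rfl).toEquiv]
  congr 1
  ext i j
  simp

/-- The permutation of `S` that sends each element to the next larger one and the largest element
to the smallest one. -/
def nextPerm {N : ℕ} (S : Finset (Fin N)) : Equiv.Perm S :=
  (S.orderIsoOfFin rfl).toEquiv.permCongr (finRotate #S)

theorem nextPerm_orderIsoOfFin {N : ℕ} (S : Finset (Fin N)) (j : Fin #S) :
    nextPerm S (S.orderIsoOfFin rfl j) = S.orderIsoOfFin rfl (finRotate #S j) := by
  simp [nextPerm, Equiv.permCongr_apply]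

theorem prod_finRotate_excWeight {R : Type*} [CommRing R] (u : R) (m : ℕ) :
    ∏ j : Fin m, (if j < finRotate m j then u else 1) = u ^ (m - 1) := by
  cases m with
  | zero => simp
  | succ m =>
    simp [Fin.prod_univ_castSucc]

theorem prod_nextPerm_excWeight {R : Type*} [CommRing R] (u : R) {N : ℕ} (S : Finset (Fin N)) :
    ∏ i : S, (if i < nextPerm S i then u else 1) = u ^ (#S - 1) := by
  rw [← prod_finRotate_excWeight, ← (S.orderIsoOfFin rfl).toEquiv.prod_comp]
  refine prod_congr rfl fun j _ => ?_
  simp [nextPerm_orderIsoOfFin]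

theorem sign_nextPerm {N : ℕ} (S : Finset (Fin N)) :
    Equiv.Perm.sign (nextPerm S) = (-1) ^ (#S - 1) := by
  rw [nextPerm, Equiv.Perm.sign_permCongr, sign_finRotate]

/-- The matrix with entries `u` above the diagonal and `1` elsewhere, in which every row indexed by
`i ∈ S` keeps only its entry in the column that follows `i` in `nextPerm S`. -/
def cycleMatrix {R : Type*} [CommRing R] (u : R) {N : ℕ} (S : Finset (Fin N)) :
    Matrix (Fin N) (Fin N) R :=
  of fun i j => if ∀ h : i ∈ S, j = nextPerm S ⟨i, h⟩ then (if i < j then u else 1) else 0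

/-- The rows in `S` vanish outside the columns in `S`, so the determinant is a product over two
blocks: a weighted permutation matrix on `S` and the unrestricted excedance matrix on the
complement. -/
theorem det_cycleMatrix {R : Type*} [CommRing R] (u : R) {N : ℕ} (S : Finset (Fin N)) :
    det (cycleMatrix u S) = (-u) ^ (#S - 1) * (1 - u) ^ (N - #S - 1) := by
  rw [twoBlockTriangular_det' _ (· ∈ S)]
  · congr 1
    · have h : toSquareBlockProp (cycleMatrix u S) (· ∈ S) = of fun i j : S =>
          (if i < nextPerm S i then u else 1) * (nextPerm S).permMatrix R i j := by
        ext i j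
        by_cases hij : j = nextPerm S i
        · subst hij
          simp [toSquareBlockProp, cycleMatrix, Equiv.toPEquiv_apply, PEquiv.toMatrix_apply]
        · have : (j : Fin N) ≠ nextPerm S i := fun h => hij (Subtype.ext h)
          simp [toSquareBlockProp, cycleMatrix, Equiv.toPEquiv_apply, PEquiv.toMatrix_apply, this,
            Ne.symm hij]
      have h' : det (of fun i j : S =>
          (if i < nextPerm S i then u else 1) * (nextPerm S).permMatrix R i j) =
            (-u) ^ (#S - 1) := by
        rw [det_mul_column, det_permutation, prod_nextPerm_excWeight, sign_nextPerm, mul_comm]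
        simp [← mul_pow]
      rw [h, ← h']
      congr!
    · have h : toSquareBlockProp (cycleMatrix u S) (· ∉ S) =
          of fun i j : {i // i ∉ S} => if i < j then u else 1 := by
        ext i j
        simp [toSquareBlockProp, cycleMatrix, i.2]
      rw [h, det_excWeight]
      simp [Fintype.card_subtype_compl]
  · intro i hi j hj
    simp only [cycleMatrix, of_apply]
    rw [if_neg]
    exact fun h => hj (by rw [h hi]; exact Subtype.prop _)

/-- The determinant of `cycleMatrix u S` enumerates the permutations that act on `S` as
`nextPerm S`. -/
theorem det_cycleMatrix_eq_sum {R : Type*} [CommRing R] (u : R) {N : ℕ} (S : Finset (Fin N)) :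
    det (cycleMatrix u S) = ∑ π : Equiv.Perm (Fin N),
      if ∀ i : S, π i = nextPerm S i then (Equiv.Perm.sign π : ℤ) * u ^ exc π else 0 := by
  -- `det_apply'` multiplies the entries `M (π i) i`; the transpose turns them into `M i (π i)`.
  rw [← det_transpose, det_apply']
  refine sum_congr rfl fun π _ => ?_
  simp only [transpose_apply, cycleMatrix, of_apply]
  split_ifs with h
  · congr 1
    rw [exc, ← prod_const, prod_filter]
    exact prod_congr rfl fun i _ => if_pos fun hi => h ⟨i, hi⟩
  · push Not at h
    obtain ⟨i, hi⟩ := h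
    rw [prod_eq_zero (mem_univ i.1), mul_zero]
    rw [if_neg]
    exact fun h => hi (h i.2)

/-! ### Permutations whose cycle through the maximum is increasing -/

theorem val_finRotate {k : ℕ} (j : Fin k) :
    (finRotate k j : ℕ) = if (j : ℕ) + 1 = k then 0 else (j : ℕ) + 1 := by
  cases k with
  | zero => exact j.elim0
  | succ k => rw [coe_finRotate]; simp [Fin.ext_iff]

section
variable {n : ℕ} {π : Equiv.Perm (Fin (n + 1))} {S : Finset (Fin (n + 1))}

theorem orderEmbOfFin_last_eq (hS : Fin.last n ∈ S) {j : Fin #S} (hj : (j : ℕ) + 1 = #S) :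
    S.orderEmbOfFin rfl j = Fin.last n := by
  have hj' : j = ⟨#S - 1, by omega⟩ := Fin.ext (by simp; omega)
  rw [hj', orderEmbOfFin_last rfl (by omega)]
  exact le_antisymm (Fin.le_last _) (le_max' _ _ hS)

/-- If `π` acts on `S` as `nextPerm S`, iterating `π` from the maximum lists `S` in increasing
order. -/
theorem pow_succ_last_of_nextPerm (hS : Fin.last n ∈ S) (h : ∀ i : S, π i = nextPerm S i)
    (j : ℕ) (hj : j < #S) : (π ^ (j + 1)) (Fin.last n) = S.orderEmbOfFin rfl ⟨j, hj⟩ := by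
  have step (j : Fin #S) :
      π (S.orderEmbOfFin rfl j) = S.orderEmbOfFin rfl (finRotate #S j) := by
    simpa [nextPerm_orderIsoOfFin] using h (S.orderIsoOfFin rfl j)
  induction j with
  | zero =>
    rw [zero_add, pow_one, ← orderEmbOfFin_last_eq hS (j := ⟨#S - 1, by omega⟩) (by simp; omega),
      step]
    congr 1
    ext
    rw [val_finRotate, if_pos (by simp; omega)]
  | succ j ih =>
    rw [pow_succ', Equiv.Perm.mul_apply, ih (by omega), step]
    congr 1
    ext
    rw [val_finRotate, if_neg (by simp; omega)]

theorem pow_minimalPeriod_last :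
    (π ^ Function.minimalPeriod π (Fin.last n)) (Fin.last n) = Fin.last n := by
  rw [Equiv.Perm.coe_pow]; exact Function.iterate_minimalPeriod

theorem minimalPeriod_last_pos : 0 < Function.minimalPeriod π (Fin.last n) :=
  Function.minimalPeriod_pos_of_mem_periodicPts
    (π.injective.mem_periodicPts _)

theorem minimalPeriod_eq_of_nextPerm (hS : Fin.last n ∈ S) (h : ∀ i : S, π i = nextPerm S i) :
    Function.minimalPeriod π (Fin.last n) = #S := by
  have hpos : 0 < #S := card_pos.mpr ⟨_, hS⟩
  have hper : Function.IsPeriodicPt π #S (Fin.last n) := by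
    have := pow_succ_last_of_nextPerm hS h (#S - 1) (by omega)
    rw [orderEmbOfFin_last_eq hS (by simp; omega), Nat.sub_add_cancel hpos,
      Equiv.Perm.coe_pow] at this
    exact this
  have hle := hper.minimalPeriod_le hpos
  have hp := minimalPeriod_last_pos (π := π)
  have hlast := pow_minimalPeriod_last (π := π)
  obtain ⟨p, hp'⟩ := Nat.exists_eq_add_one.mpr hp
  rw [hp'] at hlast hle ⊢
  rw [pow_succ_last_of_nextPerm hS h p (by omega),
    ← orderEmbOfFin_last_eq hS (j := ⟨#S - 1, by omega⟩) (by simp; omega)] at hlast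
  have := congrArg Fin.val ((S.orderEmbOfFin rfl).injective hlast)
  simp at this
  omega

/-- The set `S` is recovered from `π` as the orbit of the maximum. -/
theorem eq_image_of_nextPerm (hS : Fin.last n ∈ S) (h : ∀ i : S, π i = nextPerm S i) :
    S = (range (Function.minimalPeriod π (Fin.last n))).image
      fun j => (π ^ (j + 1)) (Fin.last n) := by
  rw [minimalPeriod_eq_of_nextPerm hS h]
  ext x
  simp only [mem_image, mem_range]
  constructor
  · intro hx
    obtain ⟨j, hj⟩ := (S.orderIsoOfFin rfl).surjective ⟨x, hx⟩
    refine ⟨j, j.2, ?_⟩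
    rw [pow_succ_last_of_nextPerm hS h j j.2]
    simpa using congrArg Subtype.val hj
  · rintro ⟨j, hj, rfl⟩
    rw [pow_succ_last_of_nextPerm hS h j hj]
    exact orderEmbOfFin_mem _ _ _

theorem isQhat_of_nextPerm (hS : Fin.last n ∈ S) (h : ∀ i : S, π i = nextPerm S i) :
    IsQhat π := by
  rw [IsQhat, minimalPeriod_eq_of_nextPerm hS h]
  rintro a ⟨ha, ha'⟩ b ⟨hb, hb'⟩ hab
  obtain ⟨a, rfl⟩ := Nat.exists_eq_add_one.mpr ha
  obtain ⟨b, rfl⟩ := Nat.exists_eq_add_one.mpr hb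
  simp only
  rw [pow_succ_last_of_nextPerm hS h a (by omega), pow_succ_last_of_nextPerm hS h b (by omega)]
  exact (S.orderEmbOfFin rfl).strictMono (by simpa using hab)

theorem IsQhat.exists_nextPerm (hπ : IsQhat π) :
    ∃ S : Finset (Fin (n + 1)), Fin.last n ∈ S ∧ ∀ i : S, π i = nextPerm S i := by
  set p := Function.minimalPeriod π (Fin.last n) with hp
  have hpos : 0 < p := minimalPeriod_last_pos
  -- `S` is the orbit of the maximum; the cycle enumerates it increasingly, hence agrees with
  -- `orderEmbOfFin`.
  set S := (range p).image fun j => (π ^ (j + 1)) (Fin.last n) with hS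
  have hmono : StrictMono fun j : Fin p => (π ^ ((j : ℕ) + 1)) (Fin.last n) := by
    intro a b hab
    refine hπ ⟨by omega, ?_⟩ ⟨by omega, ?_⟩ (by simpa using hab) <;> rw [← hp] <;> omega
  have hcard : #S = p := by
    rw [hS, card_image_of_injOn, card_range]
    intro a ha b hb hab
    exact congrArg Fin.val (hmono.injective (a₁ := ⟨a, by simpa using ha⟩)
      (a₂ := ⟨b, by simpa using hb⟩) hab)
  have hemb (j : Fin #S) : S.orderEmbOfFin rfl j = (π ^ ((j : ℕ) + 1)) (Fin.last n) := by
    have := orderEmbOfFin_unique (s := S) rfl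
      (f := fun j : Fin #S => (π ^ ((j : ℕ) + 1)) (Fin.last n))
      (fun j => mem_image.mpr ⟨j, mem_range.mpr (hcard ▸ j.2), rfl⟩)
      (fun a b hab => hmono (a := a.cast hcard) (b := b.cast hcard) hab)
    exact (congrFun this j).symm
  refine ⟨S, ?_, fun i => ?_⟩
  · refine mem_image.mpr ⟨p - 1, mem_range.mpr (by omega), ?_⟩
    rw [Nat.sub_add_cancel hpos]
    exact pow_minimalPeriod_last
  · obtain ⟨j, rfl⟩ := (S.orderIsoOfFin rfl).surjective i
    rw [nextPerm_orderIsoOfFin, coe_orderIsoOfFin_apply, coe_orderIsoOfFin_apply, hemb, hemb,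
      val_finRotate]
    split_ifs with hj
    · rw [hj, hcard, hp, pow_minimalPeriod_last, zero_add, pow_one]
    · rw [pow_succ' π ((j : ℕ) + 1), Equiv.Perm.mul_apply]

end

/-! ### The excedance generating function -/

open Classical in
/-- Every `π ∈ Qhat n` acts as `nextPerm S` on exactly one set `S` containing the maximum, and no
other permutation does so on any such set. -/
theorem sum_Qhat_eq_sum_det {R : Type*} [CommRing R] (u : R) (n : ℕ) :
    ∑ π ∈ Qhat n, ((Equiv.Perm.sign π : ℤ) : R) * u ^ exc π =
      ∑ S : Finset (Fin (n + 1)) with Fin.last n ∈ S, det (cycleMatrix u S) := by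
  simp_rw [det_cycleMatrix_eq_sum]
  rw [sum_comm, Qhat, sum_filter]
  refine sum_congr rfl fun π _ => ?_
  split_ifs with hπ
  · obtain ⟨S, hS, h⟩ := hπ.exists_nextPerm
    rw [sum_eq_single_of_mem S (by simpa using hS), if_pos h]
    intro T hT hTS
    refine if_neg fun hT' => hTS ?_
    rw [eq_image_of_nextPerm hS h]
    exact eq_image_of_nextPerm (by simpa using hT) hT'
  · refine (sum_eq_zero fun S hS => if_neg fun h => hπ ?_).symm
    exact isQhat_of_nextPerm (by simpa using hS) h

/-- The generating function is `∑ m ≤ n, C(n,m) (-u)^m (1-u)^(n-m-1)`, with the exponent read as `0`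
for `m = n`. Multiplication by `1 - u` makes this the binomial sum for `(-u + (1 - u))^n`, up to
the term `m = n`. -/
theorem one_sub_mul_sum_Qhat {R : Type*} [CommRing R] (u : R) (n : ℕ) :
    (1 - u) * ∑ π ∈ Qhat n, ((Equiv.Perm.sign π : ℤ) : R) * u ^ exc π =
      (1 - 2 * u) ^ n + (-u) ^ (n + 1) := by
  have key : ∑ S : Finset (Fin (n + 1)) with Fin.last n ∈ S, det (cycleMatrix u S) =
      ∑ m ∈ range (n + 1), n.choose m • ((-u) ^ m * (1 - u) ^ (n - m - 1)) := by
    have hc : #(univ.erase (Fin.last n)) = n := by simp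
    have hsum := sum_powerset_apply_card (fun m => (-u) ^ m * (1 - u) ^ (n - m - 1))
      (x := univ.erase (Fin.last n))
    rw [hc] at hsum
    rw [← hsum]
    refine (sum_bij (fun T _ => insert (Fin.last n) T) ?_ ?_ ?_ ?_).symm
    · simp
    · intro T hT T' hT' h
      simp only [mem_powerset, subset_erase] at hT hT'
      rw [← erase_insert hT.2, h, erase_insert hT'.2]
    · intro S hS
      refine ⟨S.erase (Fin.last n), mem_powerset.mpr (erase_subset_erase _ (subset_univ _)), ?_⟩
      exact insert_erase (by simpa using hS)
    · intro T hT
      simp only [mem_powerset, subset_erase] at hT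
      -- the exponents: `#(insert _ T) - 1 = #T` and `n + 1 - (#T + 1) - 1 = n - #T - 1`
      rw [det_cycleMatrix, card_insert_of_notMem hT.2]
      congr 2
      omega
  rw [sum_Qhat_eq_sum_det, key, sum_range_succ, mul_add, mul_sum]
  have h (m) (hm : m ∈ range n) :
      (1 - u) * n.choose m • ((-u) ^ m * (1 - u) ^ (n - m - 1)) =
        (-u) ^ m * (1 - u) ^ (n - m) * n.choose m := by
    obtain ⟨d, hd⟩ := Nat.exists_eq_add_of_lt (mem_range.mp hm)
    have h1 : n - m = d + 1 := by omega
    rw [h1, nsmul_eq_mul, Nat.add_sub_cancel]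
    ring
  have h2 : (1 - 2 * u) = -u + (1 - u) := by ring
  rw [sum_congr rfl h, h2, add_pow, sum_range_succ _ n]
  simp
  ring

/-- The sign of `π` is `(-1) ^ (N - cyc π)`, and `exc π + aexc π = N`. -/
theorem neg_one_pow_cyc {N : ℕ} (π : Equiv.Perm (Fin N)) :
    (-1 : ℤ) ^ (cyc π + aexc π) = (Equiv.Perm.sign π : ℤ) * (-1) ^ exc π := by
  have h1 : exc π + aexc π = N := by
    simpa [exc, aexc] using card_filter_add_card_filter_not (s := univ) fun i => i < π i
  have h2 : #π.support ≤ N := by simpa using card_le_univ π.support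
  have h3 : cyc π = π.cycleType.card + (N - #π.support) := by
    simp [cyc, Equiv.Perm.parts_partition]
  rw [Equiv.Perm.sign_of_cycleType, Equiv.Perm.sum_cycleType]
  push_cast
  rw [← pow_add, neg_one_pow_congr]
  rw [Nat.even_iff, Nat.even_iff]
  omega

/-! ### Comparison with `B` -/

theorem B_self (n : ℕ) : B n n = 1 := by simp [B]

/-- Consecutive alternating tail sums cancel except in the term `i = k`. -/
theorem B_add_B_succ {n k : ℕ} (hk : k ≤ n) :
    B n k + B n (k + 1) = 2 ^ (n - k) * n.choose k := by
  rw [B, ← add_sum_Ioc_eq_sum_Icc hk, B, ← Order.succ_eq_add_one, Icc_succ_left_eq_Ioc, add_assoc,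
    ← sum_add_distrib, sum_eq_zero]
  · simp
  · intro i _
    simp only [Order.succ_eq_add_one, Nat.cast_add, Nat.cast_one]
    rw [show ((k : ℤ) + 1 - i) = (k - i) + 1 by ring, _root_.zpow_add_one]
    push_cast
    ring

open Polynomial in
/-- The coefficients of the generating function at `u = -X` and the numbers `B n (n - j)` satisfy
the same first-order recurrence. -/
theorem sum_Qhat_exc (n j : ℕ) (hj : j ≤ n) :
    ∑ π ∈ Qhat n with exc π = j, (-1 : ℤ) ^ (cyc π + aexc π) = B n (n - j) := by
  set F : ℤ[X] := ∑ π ∈ Qhat n, ((Equiv.Perm.sign π : ℤ) : ℤ[X]) * (-X) ^ exc π with hF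
  have hcoeff (j : ℕ) :
      F.coeff j = ∑ π ∈ Qhat n with exc π = j, (-1 : ℤ) ^ (cyc π + aexc π) := by
    rw [hF, finsetSum_coeff, sum_filter]
    refine sum_congr rfl fun π _ => ?_
    rw [neg_one_pow_cyc, neg_pow, ← mul_assoc, ← C_eq_intCast, show (-1 : ℤ[X]) = C (-1) by simp,
      ← C_pow, ← C_mul, coeff_C_mul, coeff_X_pow]
    simp [eq_comm]
  have hmul : (1 + X) * F = (1 + 2 * X) ^ n + X ^ (n + 1) := by
    simpa using one_sub_mul_sum_Qhat (-X : ℤ[X]) n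
  have hbinom (i : ℕ) : ((1 + 2 * X : ℤ[X]) ^ n).coeff i = 2 ^ i * n.choose i := by
    have : (1 + 2 * X : ℤ[X]) ^ n = ((1 + X) ^ n).comp (C 2 * X) := by simp
    rw [this, comp_C_mul_X_coeff, coeff_one_add_X_pow, mul_comm]
  rw [← hcoeff]
  induction j with
  | zero =>
    have := congrArg (coeff · 0) hmul
    simp only [add_mul, one_mul, coeff_add, coeff_X_mul_zero, hbinom] at this
    simpa [B_self] using this
  | succ j ih =>
    have := congrArg (coeff · (j + 1)) hmul
    simp only [add_mul, one_mul, coeff_add, coeff_X_mul, hbinom, coeff_X_pow] at this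
    have hB := B_add_B_succ (n := n) (k := n - (j + 1)) (by omega)
    rw [show n - (j + 1) + 1 = n - j by omega, show n - (n - (j + 1)) = j + 1 by omega,
      Nat.choose_symm hj] at hB
    rw [ih (by omega), if_neg (by omega)] at this
    linarith

end BinomialEulerian

theorem mainTheorem2 (n k : ℕ) :
    BinomialEulerian.B n k =
      ∑ π ∈ (BinomialEulerian.Qhat n).filter
          (fun π => (BinomialEulerian.exc π : ℤ) = (n : ℤ) - (k : ℤ)),
        (-1 : ℤ) ^ (BinomialEulerian.cyc π + BinomialEulerian.aexc π) := by
  rcases le_or_gt k n with hk | hk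
  · have h := BinomialEulerian.sum_Qhat_exc n (n - k) (Nat.sub_le n k)
    rw [Nat.sub_sub_self hk] at h
    rw [← h]
    congr! 3
    omega
  · rw [BinomialEulerian.B, Finset.Icc_eq_empty (by omega), Finset.sum_empty,
      Finset.filter_false_of_mem fun π _ => by omega, Finset.sum_empty]
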